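/- Let $1\le p\le\infty$ and $1<v\le\infty$. Consider the plane $\mathbb R^2$ with the $L_p$-distance and the highway $H=\{(x,y): y=0\}$. Motion off $H$ has unit speed (with respect to the $L_p$-distance) and motion along $H$ has speed $v$. Thus a continuous curve takes the time (its $L_p$-length off $H$) $+\frac1v\,$(its length on $H$), where the second term is $0$ if $v=\infty$. A shortest time-path from $q$ to $q'$ is a continuous curve from $q$ to $q'$ whose travel time is minimal among all continuous curves from $q$ to $q'$; it uses the highway if its intersection with $H$ contains a piece of non-zero length. A curve enters $H$ when it arrives at a point of $H$ from off $H$; the incidence angle is the signed Euclidean angle between the direction of arrival and the normal of $H$, positive if the curve arrives moving to the right. For $1\le p<\infty$ put $\alpha(p,v)=0$ if $p=1$ or $v=\infty$, and otherwise $$\alpha(p,v)=\arcsin\frac{v^{1/(1-p)}}{\sqrt{v^{2/(1-p)}+\bigl(1-v^{p/(1-p)}\bigr)^{2/p}}}.$$ Let $q=(x_q,y_q)$ and $q'=(x_{q'},y_{q'})$ be any points, and let $C$ be a shortest time-path from $q$ to $q'$ that uses the highway. 1. If $1\le p<\infty$, then $C$ enters the highway with incidence angle $\alpha(p,v)$ toward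 the destination, that is, with signed incidence angle $\operatorname{sgn}(x_{q'}-x_q)\,\alpha(p,v)$, and it runs straight from $q$ to the point of entry. Moreover $\alpha(2,v)=\arcsin(1/v)$ (with $1/\infty=0$). 2. If $p=\infty$ and $v<\infty$, then $C$ enters the highway with signed incidence angle $\operatorname{sgn}(x_{q'}-x_q)\,\pi/4$, and it runs straight from $q$ to the point of entry. 3. If $p=\infty$ and $v=\infty$, then $C$ enters the highway within the angular range $[-\pi/4,\pi/4]$: for every point $P$ of $C$ before the entry, the segment from $P$ to the point of entry makes a signed angle in $[-\pi/4,\pi/4]$ with the normal of $H$, and so the incidence angle, if it exists, lies in $[-\pi/4,\pi/4]$. Conversely, if $q\notin H$, then for every $\theta\in[-\pi/4,\pi/4]$ there is a shortest time-path from $q$ to $q'$ that uses the highway and runs straight from $q$ into it with signed incidence angle $\theta$. (If $q\notin H$, then $C$ does enter the highway; if $q\in H$, then $C$ starts on the highway and the assertions concern any later entry.) -/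

import Mathlib

open Set Filter Topology
open scoped ENNReal unitInterval

noncomputable section

/-- The plane `ℝ²` with the `L_p` distance, `1 ≤ p ≤ ∞`. -/
abbrev LpPlane (p : ℝ≥0∞) : Type := PiLp p (fun _ : Fin 2 => ℝ)

/-- The highway: the `x`-axis. -/
def highway (p : ℝ≥0∞) : Set (LpPlane p) := {P | P 1 = 0}

/-- The length of the part of a curve `γ` that is traversed during the set of parameters `S`:
the outer measure of `S` generated by assigning to each interval the length (total variation) of
the corresponding arc of `γ`. -/
def lengthOn {E : Type*} [PseudoEMetricSpace E] (γ : I → E) (S : Set I) : ℝ≥0∞ :=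
  ⨅ (a : ℕ → I) (b : ℕ → I) (_ : S ⊆ ⋃ n, Icc (a n) (b n)),
    ∑' n, eVariationOn γ (Icc (a n) (b n))

/-- Travel time along a curve: unit speed off the highway, speed `v` on it.
For `v = ∞` the part on the highway takes no time. -/
def travelTime {p : ℝ≥0∞} [Fact (1 ≤ p)] (v : ℝ≥0∞) {q q' : LpPlane p} (γ : Path q q') : ℝ≥0∞ :=
  lengthOn γ {t | γ t ∉ highway p} + lengthOn γ {t | γ t ∈ highway p} / v

/-- `γ` is a shortest time-path from `q` to `q'`: no continuous curve from `q` to `q'` is faster. -/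
def IsShortestTimePath {p : ℝ≥0∞} [Fact (1 ≤ p)] (v : ℝ≥0∞) {q q' : LpPlane p}
    (γ : Path q q') : Prop :=
  ∀ γ' : Path q q', travelTime v γ ≤ travelTime v γ'

/-- `γ` uses the highway: the intersection of the curve with the highway contains a piece of
non-zero length. -/
def UsesHighway {p : ℝ≥0∞} {q q' : LpPlane p} (γ : Path q q') : Prop :=
  ∃ A B : LpPlane p, A ≠ B ∧ segment ℝ A B ⊆ range γ ∩ highway p

/-- At time `τ` the curve arrives on the highway from off the highway. -/
def IsEntryTime {p : ℝ≥0∞} {q q' : LpPlane p} (γ : Path q q') (τ : I) : Prop :=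
  γ τ ∈ highway p ∧ ∃ s < τ, ∀ t ∈ Ico s τ, γ t ∉ highway p

/-- The signed (Euclidean) angle between the segment from `P` (off the highway) to `E` (on the
highway) and the normal of the highway; it is positive if `E` lies to the right of `P`. -/
def angleToNormal {p : ℝ≥0∞} (P E : LpPlane p) : ℝ :=
  Real.arctan ((E 0 - P 0) / |E 1 - P 1|)

/-- The (signed) incidence angle of `γ` at the entry time `τ` is `θ`: the direction of arrival
at `γ τ` makes the signed angle `θ` with the normal of the highway. -/
def HasIncidenceAngle {p : ℝ≥0∞} {q q' : LpPlane p} (γ : Path q q') (τ : I) (θ : ℝ) : Prop :=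
  Tendsto (fun t => angleToNormal (γ t) (γ τ)) (𝓝[<] τ) (𝓝 θ)

/-- `γ` goes straight from its starting point `q` into the highway with signed incidence angle
`θ`, and it never enters the highway in any other way (if `q` is off the highway, it does enter;
if `q` is on the highway, it need not). -/
def EntersWithAngle {p : ℝ≥0∞} {q q' : LpPlane p} (γ : Path q q') (θ : ℝ) : Prop :=
  (q ∉ highway p → ∃ τ, IsEntryTime γ τ) ∧
    ∀ τ, IsEntryTime γ τ → γ '' Iic τ = segment ℝ q (γ τ) ∧ HasIncidenceAngle γ τ θ

open Classical in
/-- The angle `α(p, v)`, for `1 ≤ p < ∞` and `1 < v ≤ ∞`. -/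
def incidenceAngle (p v : ℝ≥0∞) : ℝ :=
  if p = 1 ∨ v = ∞ then 0
  else
    Real.arcsin (v.toReal ^ (1 / (1 - p.toReal)) /
      √(v.toReal ^ (2 / (1 - p.toReal)) +
        (1 - v.toReal ^ (p.toReal / (1 - p.toReal))) ^ (2 / p.toReal)))

end

/-! Write `w = 1/v`. A path that is on the highway first at `E` and last at `F` takes time at least
`dist q E + w * dist E F + dist F q'`, and a polygon through any two highway points takes at most
the corresponding sum. Hence the pair `(E, F)` of a shortest path minimises this sum. Since `w < 1`,
an excursion off the highway and back is strictly wasteful, so an entry can only be the first hit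
(`IsShortestTimePath.notMem_of_lt_entry`).

The initial arc may be cut at any earlier point `P` of the path. Therefore `E`, with abscissa `e`,
minimises `dist P x + w * |x - f|` over highway points `x`, for every such `P`
(`IsShortestTimePath.exists_exit`, `IsShortestTimePath.exists_exit_abscissa`). Except when `p = v =
∞`, this one-variable problem fixes the slope `(e - P 0) / |P 1|` independently of `P`: by a
derivative if `1 < p < ∞` and `v < ∞` (`slope_of_optimal`), by direct comparison otherwise. All `P`
then lie on one line through `E`, which yields the angle and the straightness together, even where
`L_p` geodesics are not unique. If `p = v = ∞`, the minimisers fill the interval `|x - P 0| ≤ |P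
1|`, which is the angular range. -/

/-! ### Length as an outer measure generated by arcs -/

section Length

variable {E : Type*}

section PseudoEMetric

variable [PseudoEMetricSpace E] {γ : I → E} {S T : Set I}

theorem lengthOn_le_tsum {a b : ℕ → I} (h : S ⊆ ⋃ n, Icc (a n) (b n)) :
    lengthOn γ S ≤ ∑' n, eVariationOn γ (Icc (a n) (b n)) :=
  iInf_le_of_le a (iInf_le_of_le b (iInf_le_of_le h le_rfl))

theorem lengthOn_mono (h : S ⊆ T) : lengthOn γ S ≤ lengthOn γ T :=
  le_iInf fun _ => le_iInf fun _ => le_iInf fun hT => lengthOn_le_tsum (h.trans hT)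

theorem lengthOn_union_le : lengthOn γ (S ∪ T) ≤ lengthOn γ S + lengthOn γ T := by
  simp only [lengthOn, ENNReal.iInf_add, ENNReal.add_iInf, le_iInf_iff]
  intro a' b' hT a b hS
  let e := Equiv.natSumNatEquivNat
  refine (lengthOn_le_tsum (a := fun n => Sum.elim a a' (e.symm n))
    (b := fun n => Sum.elim b b' (e.symm n)) ?_).trans ?_
  · rintro x (hx | hx)
    · obtain ⟨n, hn⟩ := mem_iUnion.1 (hS hx)
      exact mem_iUnion.2 ⟨e (Sum.inl n), by simpa using hn⟩
    · obtain ⟨n, hn⟩ := mem_iUnion.1 (hT hx)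
      exact mem_iUnion.2 ⟨e (Sum.inr n), by simpa using hn⟩
  · rw [e.symm.tsum_eq (fun k => eVariationOn γ (Icc (Sum.elim a a' k) (Sum.elim b b' k))),
      Summable.tsum_sum ENNReal.summable ENNReal.summable]
    simp

theorem lengthOn_le_eVariationOn {a b : I} (h : S ⊆ Icc a b) :
    lengthOn γ S ≤ eVariationOn γ (Icc a b) := by
  -- The cover is padded with the degenerate interval `[1, 1]`, which has zero variation.
  refine (lengthOn_le_tsum (a := fun n => if n = 0 then a else 1)
    (b := fun n => if n = 0 then b else 1) fun x hx => mem_iUnion.2 ⟨0, by simpa using h hx⟩).trans ?_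
  rw [tsum_eq_single 0]
  · simp
  · intro n hn
    simp [hn]

theorem lengthOn_of_subsingleton (h : S.Subsingleton) : lengthOn γ S = 0 := by
  obtain rfl | ⟨x, rfl⟩ := h.eq_empty_or_singleton
  · exact le_antisymm ((lengthOn_le_eVariationOn (a := 0) (b := 0) (empty_subset _)).trans
      (by simp)) zero_le
  · exact le_antisymm ((lengthOn_le_eVariationOn (a := x) (b := x) (by simp)).trans
      (by simp)) zero_le

/-- Cutting every interval of a cover at `τ` gives covers of both parts, and variation is
superadditive across the cut. -/
theorem lengthOn_inter_Iic_add_inter_Ici_le (τ : I) :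
    lengthOn γ (S ∩ Iic τ) + lengthOn γ (S ∩ Ici τ) ≤ lengthOn γ S := by
  refine le_iInf fun a => le_iInf fun b => le_iInf fun h => ?_
  have h₁ : S ∩ Iic τ ⊆ ⋃ n, Icc (a n) (min (b n) τ) := by
    rintro x ⟨hx, hxτ⟩
    obtain ⟨n, hn⟩ := mem_iUnion.1 (h hx)
    exact mem_iUnion.2 ⟨n, hn.1, le_min hn.2 hxτ⟩
  have h₂ : S ∩ Ici τ ⊆ ⋃ n, Icc (max (a n) τ) (b n) := by
    rintro x ⟨hx, hxτ⟩
    obtain ⟨n, hn⟩ := mem_iUnion.1 (h hx)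
    exact mem_iUnion.2 ⟨n, max_le hn.1 hxτ, hn.2⟩
  refine (add_le_add (lengthOn_le_tsum h₁) (lengthOn_le_tsum h₂)).trans ?_
  rw [← ENNReal.tsum_add]
  refine ENNReal.tsum_le_tsum fun n => ?_
  refine (eVariationOn.add_le_union γ fun x hx y hy =>
    (hx.2.trans (min_le_right _ _)).trans ((le_max_right _ _).trans hy.1)).trans ?_
  exact eVariationOn.mono γ (union_subset (Icc_subset_Icc_right (min_le_left _ _))
    (Icc_subset_Icc_left (le_max_left _ _)))

theorem lengthOn_image_le {f g : I → E} {φ ψ : I → I} (hφ : Monotone φ) (hψ : Monotone ψ)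
    (hψφ : ∀ t, ψ (φ t) = t) (hfg : ∀ t ∈ Icc (φ 0) (φ 1), f t = g (ψ t)) (S : Set I) :
    lengthOn f (φ '' S) ≤ lengthOn g S := by
  refine le_iInf fun a => le_iInf fun b => le_iInf fun h => ?_
  refine (lengthOn_le_tsum (a := fun n => φ (a n)) (b := fun n => φ (b n)) ?_).trans
    (ENNReal.tsum_le_tsum fun n => ?_)
  · rintro _ ⟨x, hx, rfl⟩
    obtain ⟨n, hn⟩ := mem_iUnion.1 (h hx)
    exact mem_iUnion.2 ⟨n, hφ hn.1, hφ hn.2⟩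
  · rw [eVariationOn.eq_of_eqOn (f' := g ∘ ψ) fun t ht =>
      hfg t ⟨(hφ unitInterval.nonneg').trans ht.1, ht.2.trans (hφ unitInterval.le_one')⟩]
    refine eVariationOn.comp_le_of_monotoneOn g ψ (hψ.monotoneOn _) fun t ht => ?_
    rw [← hψφ (a n), ← hψφ (b n)]
    exact ⟨hψ ht.1, hψ ht.2⟩

end PseudoEMetric

section PseudoMetric

variable [PseudoMetricSpace E] {γ : I → E}

/-- The distance to `γ s` is a real function along the curve. By the intermediate value theorem its
images of the covering intervals cover `[0, dist (γ s) (γ t)]`, and each image has Lebesgue measure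
at most the variation of its arc. -/
theorem edist_le_lengthOn_Icc (hγ : Continuous γ) {s t : I} (hst : s ≤ t) :
    edist (γ s) (γ t) ≤ lengthOn γ (Icc s t) := by
  refine le_iInf fun a => le_iInf fun b => le_iInf fun h => ?_
  let f : I → ℝ := fun u => dist (γ s) (γ u)
  have hf : Continuous f := by fun_prop
  have hsub : Icc 0 (dist (γ s) (γ t)) ⊆ ⋃ n, f '' Icc (a n) (b n) := by
    have h0 : Icc (f s) (f t) ⊆ f '' Icc s t := intermediate_value_Icc hst hf.continuousOn
    simp only [f, dist_self] at h0
    refine h0.trans ((image_mono h).trans ?_)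
    rw [image_iUnion]
  calc edist (γ s) (γ t) = MeasureTheory.volume (Icc 0 (dist (γ s) (γ t))) := by
        rw [Real.volume_Icc, sub_zero, edist_dist]
    _ ≤ MeasureTheory.volume (⋃ n, f '' Icc (a n) (b n)) := MeasureTheory.measure_mono hsub
    _ ≤ ∑' n, MeasureTheory.volume (f '' Icc (a n) (b n)) := MeasureTheory.measure_iUnion_le _
    _ ≤ _ := ENNReal.tsum_le_tsum fun n => (Real.volume_le_diam _).trans ?_
  refine Metric.ediam_le ?_
  rintro _ ⟨x, hx, rfl⟩ _ ⟨y, hy, rfl⟩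
  refine le_trans ?_ (eVariationOn.edist_le γ hx hy)
  rw [edist_dist, edist_dist, Real.dist_eq]
  refine ENNReal.ofReal_le_ofReal ?_
  simp only [f, dist_comm (γ s)]
  exact abs_dist_sub_le _ _ _

theorem edist_le_lengthOn_Ioo (hγ : Continuous γ) {s t : I} (hst : s ≤ t) :
    edist (γ s) (γ t) ≤ lengthOn γ (Ioo s t) := by
  refine (edist_le_lengthOn_Icc hγ hst).trans ?_
  have hp : ({s, t} : Set I) = {s} ∪ {t} := rfl
  have h0 : ∀ x : I, lengthOn γ {x} = 0 := fun x => lengthOn_of_subsingleton subsingleton_singleton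
  calc lengthOn γ (Icc s t) = lengthOn γ (Ioo s t ∪ ({s} ∪ {t})) := by
        rw [← hp, Ioo_union_both hst]
    _ ≤ lengthOn γ (Ioo s t) + (lengthOn γ {s} + lengthOn γ {t}) := by
        grw [lengthOn_union_le, lengthOn_union_le]
    _ = lengthOn γ (Ioo s t) := by rw [h0, h0, add_zero, add_zero]

end PseudoMetric

end Length

/-! ### Travel time of arcs, concatenations and segments -/

section TravelTime

variable {p : ℝ≥0∞} [Fact (1 ≤ p)] {v : ℝ≥0∞}

/-- The time spent along `γ` during the set of parameters `S`. -/
noncomputable def timeOn (v : ℝ≥0∞) (γ : I → LpPlane p) (S : Set I) : ℝ≥0∞ :=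
  lengthOn γ (S ∩ {t | γ t ∉ highway p}) + lengthOn γ (S ∩ {t | γ t ∈ highway p}) / v

theorem travelTime_eq_timeOn {q q' : LpPlane p} (γ : Path q q') :
    travelTime v γ = timeOn v γ (Icc 0 1) := by
  have h : (Icc 0 1 : Set I) = univ := eq_univ_of_forall fun t =>
    ⟨unitInterval.nonneg', unitInterval.le_one'⟩
  rw [timeOn, h, univ_inter, univ_inter, travelTime]

theorem timeOn_Icc_add_Icc_le {γ : I → LpPlane p} {r s t : I} (hrs : r ≤ s) (hst : s ≤ t) :
    timeOn v γ (Icc r s) + timeOn v γ (Icc s t) ≤ timeOn v γ (Icc r t) := by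
  have key : ∀ S : Set I, lengthOn γ (Icc r s ∩ S) + lengthOn γ (Icc s t ∩ S) ≤
      lengthOn γ (Icc r t ∩ S) := fun S => by
    refine le_trans ?_ (lengthOn_inter_Iic_add_inter_Ici_le s)
    exact add_le_add (lengthOn_mono fun x hx => ⟨⟨⟨hx.1.1, hx.1.2.trans hst⟩, hx.2⟩, hx.1.2⟩)
      (lengthOn_mono fun x hx => ⟨⟨⟨hrs.trans hx.1.1, hx.1.2⟩, hx.2⟩, hx.1.1⟩)
  refine le_trans (le_of_eq ?_) (add_le_add (key _) (ENNReal.div_le_div_right (key _) v))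
  simp only [timeOn, ENNReal.add_div]
  ring

theorem edist_le_timeOn {γ : I → LpPlane p} (hγ : Continuous γ) {s t : I} (hst : s ≤ t)
    (h : ∀ u ∈ Ioo s t, γ u ∉ highway p) : edist (γ s) (γ t) ≤ timeOn v γ (Icc s t) :=
  have hsub : Ioo s t ⊆ Icc s t ∩ {t | γ t ∉ highway p} :=
    fun u hu => ⟨Ioo_subset_Icc_self hu, h u hu⟩
  (edist_le_lengthOn_Ioo hγ hst).trans ((lengthOn_mono hsub).trans le_self_add)

/-- The speed is nowhere above `v`, so even the part off the highway costs at least its length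
divided by `v`. -/
theorem edist_div_le_timeOn (hv : 1 ≤ v) {γ : I → LpPlane p} (hγ : Continuous γ) {s t : I}
    (hst : s ≤ t) : edist (γ s) (γ t) / v ≤ timeOn v γ (Icc s t) := by
  have h1 : edist (γ s) (γ t) ≤ lengthOn γ (Icc s t ∩ {t | γ t ∉ highway p}) +
      lengthOn γ (Icc s t ∩ {t | γ t ∈ highway p}) := by
    refine (edist_le_lengthOn_Icc hγ hst).trans (le_trans (lengthOn_mono fun u hu => ?_)
      lengthOn_union_le)
    by_cases h : γ u ∈ highway p
    · exact Or.inr ⟨hu, h⟩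
    · exact Or.inl ⟨hu, h⟩
  refine (ENNReal.div_le_div_right h1 v).trans ?_
  rw [ENNReal.add_div]
  refine add_le_add_left ?_ _
  exact ENNReal.div_le_of_le_mul (le_mul_of_one_le_right zero_le hv)

theorem travelTime_trans_le {q₀ q₁ q₂ : LpPlane p} (γ : Path q₀ q₁) (γ' : Path q₁ q₂) :
    travelTime v (γ.trans γ') ≤ travelTime v γ + travelTime v γ' := by
  -- `φ₁` and `φ₂` embed the parameter interval as its two halves; `ψ₁` and `ψ₂` are monotone left
  -- inverses, made total by clamping.
  let φ₁ : I → I := fun t => ⟨(t : ℝ) / 2, by constructor <;> linarith [t.2.1, t.2.2]⟩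
  let φ₂ : I → I := fun t => ⟨((t : ℝ) + 1) / 2, by constructor <;> linarith [t.2.1, t.2.2]⟩
  let ψ₁ : I → I := fun t => projIcc 0 1 zero_le_one (2 * (t : ℝ))
  let ψ₂ : I → I := fun t => projIcc 0 1 zero_le_one (2 * (t : ℝ) - 1)
  have hφ₁ : Monotone φ₁ := fun s t (h : (s : ℝ) ≤ t) =>
    Subtype.coe_le_coe.1 (by simp only [φ₁]; linarith)
  have hφ₂ : Monotone φ₂ := fun s t (h : (s : ℝ) ≤ t) =>
    Subtype.coe_le_coe.1 (by simp only [φ₂]; linarith)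
  have hψ₁ : Monotone ψ₁ := fun s t (h : (s : ℝ) ≤ t) => monotone_projIcc _ (by linarith)
  have hψ₂ : Monotone ψ₂ := fun s t (h : (s : ℝ) ≤ t) => monotone_projIcc _ (by linarith)
  have h₁ : ∀ t, ψ₁ (φ₁ t) = t := fun t => by
    simp only [ψ₁, φ₁, mul_div_cancel₀ (t : ℝ) (two_ne_zero)]
    exact projIcc_val _ t
  have h₂ : ∀ t, ψ₂ (φ₂ t) = t := fun t => by
    have : 2 * (((t : ℝ) + 1) / 2) - 1 = t := by ring
    simp only [ψ₂, φ₂, this]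
    exact projIcc_val _ t
  have hf₁ : ∀ t ∈ Icc (φ₁ 0) (φ₁ 1), (γ.trans γ') t = γ (ψ₁ t) := fun t ht => by
    have : (t : ℝ) ≤ 1 / 2 := by simpa [φ₁] using Subtype.coe_le_coe.2 ht.2
    rw [Path.trans_apply, dif_pos this]
    congr 1
    exact (projIcc_of_mem zero_le_one _).symm
  have hf₂ : ∀ t ∈ Icc (φ₂ 0) (φ₂ 1), (γ.trans γ') t = γ' (ψ₂ t) := fun t ht => by
    have h : 1 / 2 ≤ (t : ℝ) := by simpa [φ₂] using Subtype.coe_le_coe.2 ht.1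
    obtain h | h := h.eq_or_lt
    · rw [Path.trans_apply, dif_pos h.ge]
      have e1 : (⟨2 * t, (unitInterval.mul_pos_mem_iff zero_lt_two).2 ⟨t.2.1, h.ge⟩⟩ : I) = 1 :=
        Subtype.ext (by simp [← h])
      have e2 : ψ₂ t = 0 := by simp [ψ₂, ← h]
      rw [e1, e2, γ.target, γ'.source]
    · rw [Path.trans_apply, dif_neg (not_le.2 h)]
      congr 1
      exact (projIcc_of_mem zero_le_one _).symm
  have key : ∀ A : Set (LpPlane p), lengthOn (γ.trans γ') {t | (γ.trans γ') t ∈ A} ≤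
      lengthOn γ {t | γ t ∈ A} + lengthOn γ' {t | γ' t ∈ A} := fun A => by
    refine le_trans (lengthOn_mono ?_) (lengthOn_union_le.trans
      (add_le_add (lengthOn_image_le hφ₁ hψ₁ h₁ hf₁ _) (lengthOn_image_le hφ₂ hψ₂ h₂ hf₂ _)))
    intro t ht
    obtain h | h := le_total (t : ℝ) (1 / 2)
    · have hmem : t ∈ Icc (φ₁ 0) (φ₁ 1) :=
        ⟨Subtype.coe_le_coe.1 (by simpa [φ₁] using t.2.1),
          Subtype.coe_le_coe.1 (by simpa [φ₁] using h)⟩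
      refine Or.inl ⟨ψ₁ t, ?_, Subtype.ext ?_⟩
      · rw [mem_ofPred_eq, ← hf₁ t hmem]; exact ht
      · simp only [ψ₁, φ₁]
        rw [projIcc_of_mem zero_le_one (x := 2 * (t : ℝ)) ⟨by linarith [t.2.1], by linarith⟩]
        simp
    · have hmem : t ∈ Icc (φ₂ 0) (φ₂ 1) :=
        ⟨Subtype.coe_le_coe.1 (by simpa [φ₂] using h),
          Subtype.coe_le_coe.1 (by simpa [φ₂] using t.2.2)⟩
      refine Or.inr ⟨ψ₂ t, ?_, Subtype.ext ?_⟩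
      · rw [mem_ofPred_eq, ← hf₂ t hmem]; exact ht
      · simp only [ψ₂, φ₂]
        rw [projIcc_of_mem zero_le_one (x := 2 * (t : ℝ) - 1) ⟨by linarith, by linarith [t.2.2]⟩]
        simp
  refine (add_le_add (key (highway p)ᶜ) (ENNReal.div_le_div_right (key (highway p)) v)).trans
    (le_of_eq ?_)
  simp only [travelTime, ENNReal.add_div, mem_compl_iff]
  ring

theorem eVariationOn_segment_le (P Q : LpPlane p) (S : Set I) :
    eVariationOn (Path.segment P Q) S ≤ edist P Q := by
  refine (eVariationOn.mono _ (t := S) (s := univ ∩ Icc (0 : I) 1)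
    fun t _ => ⟨trivial, unitInterval.nonneg', unitInterval.le_one'⟩).trans ?_
  have hmono : MonotoneOn ((↑) : I → ℝ) univ := fun s _ t _ h => h
  refine ((lipschitzWith_lineMap (𝕜 := ℝ) P Q).lipschitzOnWith (s := univ)
    |>.comp_eVariationOn_le (g := ((↑) : I → ℝ)) (mapsTo_univ _ _)).trans ?_
  rw [hmono.eVariationOn_eq (mem_univ _) (mem_univ _)]
  rw [edist_nndist]; simp

theorem mem_highway {p : ℝ≥0∞} {P : LpPlane p} : P ∈ highway p ↔ P 1 = 0 := Iff.rfl

theorem segment_apply_coord (P Q : LpPlane p) (t : I) (i : Fin 2) :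
    Path.segment P Q t i = P i + t * (Q i - P i) := by
  simp [AffineMap.lineMap_apply]; ring

/-- Such a segment either lies in the highway or meets it at a single parameter, which has zero
length. -/
theorem travelTime_segment_le (hv : 1 ≤ v) {P Q : LpPlane p}
    (h : P ∈ highway p ∨ Q ∈ highway p) : travelTime v (Path.segment P Q) ≤ edist P Q := by
  have hl : ∀ S : Set I, lengthOn (Path.segment P Q) S ≤ edist P Q := fun S =>
    (lengthOn_le_eVariationOn (a := 0) (b := 1) fun t _ =>
      ⟨unitInterval.nonneg', unitInterval.le_one'⟩).trans (eVariationOn_segment_le P Q _)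
  by_cases hPQ : P ∈ highway p ∧ Q ∈ highway p
  · have h0 : {t | Path.segment P Q t ∉ highway p} = ∅ := by
      refine eq_empty_of_forall_notMem fun t ht => ht ?_
      rw [mem_highway, segment_apply_coord, hPQ.1, hPQ.2]; simp
    rw [travelTime, h0, lengthOn_of_subsingleton subsingleton_empty, zero_add]
    exact ENNReal.div_le_of_le_mul ((hl _).trans (le_mul_of_one_le_right zero_le hv))
  · have h0 : {t | Path.segment P Q t ∈ highway p}.Subsingleton := by
      intro s hs t ht
      simp only [mem_ofPred_eq, mem_highway, segment_apply_coord] at hs ht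
      simp only [mem_highway] at h hPQ
      have hne : Q 1 - P 1 ≠ 0 := by
        rcases h with h | h
        · rw [h, sub_zero]; exact fun h' => hPQ ⟨h, h'⟩
        · rw [h, zero_sub]; exact fun h' => hPQ ⟨neg_eq_zero.1 h', h⟩
      have : ((s : ℝ) - t) * (Q 1 - P 1) = 0 := by linarith
      exact Subtype.ext (sub_eq_zero.1 ((mul_eq_zero.1 this).resolve_right hne))
    rw [travelTime, lengthOn_of_subsingleton h0, ENNReal.zero_div, add_zero]
    exact hl _

theorem travelTime_segment_highway_le {P Q : LpPlane p}
    (hP : P ∈ highway p) (hQ : Q ∈ highway p) :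
    travelTime v (Path.segment P Q) ≤ edist P Q / v := by
  have hl : ∀ S : Set I, lengthOn (Path.segment P Q) S ≤ edist P Q := fun S =>
    (lengthOn_le_eVariationOn (a := 0) (b := 1) fun t _ =>
      ⟨unitInterval.nonneg', unitInterval.le_one'⟩).trans (eVariationOn_segment_le P Q _)
  have h0 : {t | Path.segment P Q t ∉ highway p} = ∅ := by
    refine eq_empty_of_forall_notMem fun t ht => ht ?_
    rw [mem_highway, segment_apply_coord, hP, hQ]; simp
  rw [travelTime, h0, lengthOn_of_subsingleton subsingleton_empty, zero_add]
  exact ENNReal.div_le_div_right (hl _) v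

theorem edist_div_eq (hv : 1 < v) (P Q : LpPlane p) :
    edist P Q / v = ENNReal.ofReal ((v⁻¹).toReal * dist P Q) := by
  have : v⁻¹ ≠ ∞ := ENNReal.inv_ne_top.2 (zero_lt_one.trans hv).ne'
  rw [ENNReal.ofReal_mul ENNReal.toReal_nonneg, ENNReal.ofReal_toReal this, ← edist_dist,
    div_eq_mul_inv, mul_comm]

end TravelTime

/-! ### The `L_p` distance in coordinates -/

section Distance

variable {p : ℝ≥0∞} [Fact (1 ≤ p)]

theorem dist_eq_rpow (hp : p ≠ ∞) (P Q : LpPlane p) :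
    dist P Q = (|P 0 - Q 0| ^ p.toReal + |P 1 - Q 1| ^ p.toReal) ^ (1 / p.toReal) := by
  have h : 0 < p.toReal := ENNReal.toReal_pos (zero_lt_one.trans_le Fact.out).ne' hp
  rw [PiLp.dist_eq_sum h, Fin.sum_univ_two, Real.dist_eq, Real.dist_eq]

theorem dist_eq_max (P Q : LpPlane ∞) : dist P Q = max |P 0 - Q 0| |P 1 - Q 1| := by
  rw [PiLp.dist_eq_iSup]
  refine le_antisymm (ciSup_le fun i => ?_) (max_le ?_ ?_)
  · fin_cases i
    · exact le_max_left _ _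
    · exact le_max_right _ _
  · exact le_ciSup (f := fun i => dist (P i) (Q i)) (Set.finite_range _).bddAbove 0
  · exact le_ciSup (f := fun i => dist (P i) (Q i)) (Set.finite_range _).bddAbove 1

theorem dist_one_eq_add (P Q : LpPlane 1) : dist P Q = |P 0 - Q 0| + |P 1 - Q 1| := by
  rw [dist_eq_rpow ENNReal.one_ne_top]; simp

theorem dist_le_dist_of_abs_le {P Q P' Q' : LpPlane p} (h₀ : |P 0 - Q 0| ≤ |P' 0 - Q' 0|)
    (h₁ : |P 1 - Q 1| ≤ |P' 1 - Q' 1|) : dist P Q ≤ dist P' Q' := by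
  by_cases hp : p = ∞
  · subst hp
    rw [dist_eq_max, dist_eq_max]
    exact max_le_max h₀ h₁
  · rw [dist_eq_rpow hp, dist_eq_rpow hp]
    gcongr

theorem abs_sub_le_dist (P Q : LpPlane p) (i : Fin 2) : |P i - Q i| ≤ dist P Q := by
  simpa [dist_eq_norm] using PiLp.norm_apply_le (P - Q) i

theorem dist_of_fst_eq {P Q : LpPlane p} (h : P 0 = Q 0) : dist P Q = |P 1 - Q 1| := by
  by_cases hp : p = ∞
  · subst hp
    rw [dist_eq_max, h]; simp
  · have hp0 : p.toReal ≠ 0 := (ENNReal.toReal_pos (zero_lt_one.trans_le Fact.out).ne' hp).ne'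
    rw [dist_eq_rpow hp, h, sub_self, abs_zero, Real.zero_rpow hp0, zero_add,
      ← Real.rpow_mul (abs_nonneg _), mul_one_div_cancel hp0, Real.rpow_one]

theorem dist_of_snd_eq {P Q : LpPlane p} (h : P 1 = Q 1) : dist P Q = |P 0 - Q 0| := by
  by_cases hp : p = ∞
  · subst hp
    rw [dist_eq_max, h]; simp
  · have hp0 : p.toReal ≠ 0 := (ENNReal.toReal_pos (zero_lt_one.trans_le Fact.out).ne' hp).ne'
    rw [dist_eq_rpow hp, h, sub_self, abs_zero, Real.zero_rpow hp0, add_zero,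
      ← Real.rpow_mul (abs_nonneg _), mul_one_div_cancel hp0, Real.rpow_one]

theorem dist_of_mem_highway {P Q : LpPlane p} (hP : P ∈ highway p) (hQ : Q ∈ highway p) :
    dist P Q = |P 0 - Q 0| := dist_of_snd_eq (hP.trans hQ.symm)

/-- The point of the highway with the given abscissa. -/
def highwayPoint (p : ℝ≥0∞) (x : ℝ) : LpPlane p := WithLp.toLp p ![x, 0]

@[simp] theorem highwayPoint_zero {p : ℝ≥0∞} (x : ℝ) : highwayPoint p x 0 = x := rfl

@[simp] theorem highwayPoint_one {p : ℝ≥0∞} (x : ℝ) : highwayPoint p x 1 = 0 := rfl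

theorem highwayPoint_mem {p : ℝ≥0∞} (x : ℝ) : highwayPoint p x ∈ highway p := rfl

theorem isClosed_highway {p : ℝ≥0∞} : IsClosed (highway p) :=
  isClosed_eq (PiLp.continuous_apply p _ 1) continuous_const

end Distance

/-! ### Comparison with polygons and optimality of the entry point -/

section Bounds

variable {p : ℝ≥0∞} [Fact (1 ≤ p)] {v : ℝ≥0∞}

theorem ofReal_add_le_timeOn {γ : I → LpPlane p} {r s t : I} {x y : ℝ} (hrs : r ≤ s) (hst : s ≤ t)
    (hx : ENNReal.ofReal x ≤ timeOn v γ (Icc r s)) (hy : ENNReal.ofReal y ≤ timeOn v γ (Icc s t)) :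
    ENNReal.ofReal (x + y) ≤ timeOn v γ (Icc r t) :=
  ENNReal.ofReal_add_le.trans ((add_le_add hx hy).trans (timeOn_Icc_add_Icc_le hrs hst))

theorem ofReal_dist_le_timeOn {γ : I → LpPlane p} (hγ : Continuous γ) {s t : I} (hst : s ≤ t)
    (h : ∀ u ∈ Ioo s t, γ u ∉ highway p) :
    ENNReal.ofReal (dist (γ s) (γ t)) ≤ timeOn v γ (Icc s t) := by
  rw [← edist_dist]
  exact edist_le_timeOn hγ hst h

theorem ofReal_mul_dist_le_timeOn (hv : 1 < v) {γ : I → LpPlane p} (hγ : Continuous γ) {s t : I}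
    (hst : s ≤ t) : ENNReal.ofReal ((v⁻¹).toReal * dist (γ s) (γ t)) ≤ timeOn v γ (Icc s t) := by
  rw [← edist_div_eq hv]
  exact edist_div_le_timeOn hv.le hγ hst

theorem toReal_inv_lt_one (hv : 1 < v) : (v⁻¹).toReal < 1 := by
  have : v⁻¹ < 1 := ENNReal.inv_lt_one.2 hv
  simpa using ENNReal.toReal_strict_mono ENNReal.one_ne_top this

/-- The polygonal path from `q` via `E` and `F` to `q'`. -/
noncomputable def viaPath (q E F q' : LpPlane p) : Path q q' :=
  (Path.segment q E).trans ((Path.segment E F).trans (Path.segment F q'))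

theorem travelTime_viaPath_le (hv : 1 < v) (q q' : LpPlane p) {E F : LpPlane p}
    (hE : E ∈ highway p) (hF : F ∈ highway p) : travelTime v (viaPath q E F q') ≤
      ENNReal.ofReal (dist q E + (v⁻¹).toReal * dist E F + dist F q') := by
  refine (travelTime_trans_le _ _).trans ((add_le_add_right (travelTime_trans_le _ _) _).trans ?_)
  rw [ENNReal.ofReal_add (by positivity) (by positivity),
    ENNReal.ofReal_add (by positivity) (by positivity), ← edist_dist, ← edist_dist,
    ← edist_div_eq hv, ← add_assoc]
  exact add_le_add (add_le_add (travelTime_segment_le hv.le (Or.inr hE))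
    (travelTime_segment_highway_le hE hF)) (travelTime_segment_le hv.le (Or.inl hF))

theorem exists_first_last_hit {p : ℝ≥0∞} {q q' : LpPlane p} (γ : Path q q') (h : ∃ t, γ t ∈ highway p) :
    ∃ a b : I, γ a ∈ highway p ∧ γ b ∈ highway p ∧ ∀ t, γ t ∈ highway p → a ≤ t ∧ t ≤ b := by
  have hc : IsCompact {t | γ t ∈ highway p} := (isClosed_highway.preimage γ.continuous).isCompact
  obtain ⟨a, ha⟩ := hc.exists_isLeast h
  obtain ⟨b, hb⟩ := hc.exists_isGreatest h
  exact ⟨a, b, ha.1, hb.1, fun t ht => ⟨ha.2 ht, hb.2 ht⟩⟩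

theorem UsesHighway.exists_ne {p : ℝ≥0∞} {q q' : LpPlane p} {γ : Path q q'} (h : UsesHighway γ)
    (E : LpPlane p) : ∃ t, γ t ∈ highway p ∧ γ t ≠ E := by
  obtain ⟨A, B, hAB, hs⟩ := h
  obtain ⟨⟨s, rfl⟩, hs'⟩ := hs (left_mem_segment ℝ A B)
  obtain ⟨⟨t, rfl⟩, ht'⟩ := hs (right_mem_segment ℝ _ B)
  by_cases hE : γ s = E
  · exact ⟨t, ht', fun h => hAB (hE.trans h.symm)⟩
  · exact ⟨s, hs', hE⟩

theorem IsShortestTimePath.le_of_ofReal_le (hv : 1 < v) {q q' : LpPlane p} {γ : Path q q'}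
    (hγ : IsShortestTimePath v γ) {x : ℝ} (hx : ENNReal.ofReal x ≤ timeOn v γ (Icc 0 1))
    {E F : LpPlane p} (hE : E ∈ highway p) (hF : F ∈ highway p) :
    x ≤ dist q E + (v⁻¹).toReal * dist E F + dist F q' := by
  rw [← travelTime_eq_timeOn] at hx
  have := hx.trans ((hγ _).trans (travelTime_viaPath_le hv q q' hE hF))
  exact (ENNReal.ofReal_le_ofReal_iff (by positivity)).1 this

/-- A shortest time-path enters the highway at most at its first time on the highway. -/
theorem IsShortestTimePath.notMem_of_lt_entry (hv : 1 < v) {q q' : LpPlane p} {γ : Path q q'}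
    (hγ : IsShortestTimePath v γ) {τ : I} (hτ : IsEntryTime γ τ) :
    ∀ t < τ, γ t ∉ highway p := by
  obtain ⟨a, b, ha, hb, hab⟩ := exists_first_last_hit γ ⟨τ, hτ.1⟩
  obtain ⟨hτH, s, hsτ, hs⟩ := hτ
  intro t htτ htH
  have haτ : a < τ := (hab t htH).1.trans_lt htτ
  have hτb := (hab τ hτH).2
  have has : a < s := lt_of_not_ge fun h => hs a ⟨h, haτ⟩ ha
  -- `c` is the last highway time before `s`, so the curve is off the highway throughout the
  -- excursion from `c` to `τ`.
  have hcpt : IsCompact ({t | γ t ∈ highway p} ∩ Icc a s) :=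
    ((isClosed_highway.preimage γ.continuous).inter isClosed_Icc).isCompact
  obtain ⟨c, ⟨hc_mem, hac, hc_le⟩, hc⟩ := hcpt.exists_isGreatest ⟨a, ha, left_mem_Icc.2 has.le⟩
  have hsH : γ s ∉ highway p := hs s ⟨le_rfl, hsτ⟩
  have hoff : ∀ u ∈ Ioo c s, γ u ∉ highway p := fun u hu h =>
    (hc ⟨h, hac.trans hu.1.le, hu.2.le⟩).not_gt hu.1
  have key : ENNReal.ofReal (dist (γ 0) (γ a) + ((v⁻¹).toReal * dist (γ a) (γ c) +
      (dist (γ c) (γ s) + (dist (γ s) (γ τ) + ((v⁻¹).toReal * dist (γ τ) (γ b) +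
        dist (γ b) (γ 1)))))) ≤ timeOn v γ (Icc 0 1) :=
    ofReal_add_le_timeOn unitInterval.nonneg' unitInterval.le_one'
      (ofReal_dist_le_timeOn γ.continuous unitInterval.nonneg'
        fun u hu h => (hab u h).1.not_gt hu.2) <|
    ofReal_add_le_timeOn hac unitInterval.le_one'
      (ofReal_mul_dist_le_timeOn hv γ.continuous hac) <|
    ofReal_add_le_timeOn hc_le unitInterval.le_one' (ofReal_dist_le_timeOn γ.continuous hc_le hoff) <|
    ofReal_add_le_timeOn hsτ.le unitInterval.le_one'
      (ofReal_dist_le_timeOn γ.continuous hsτ.le fun u hu => hs u ⟨hu.1.le, hu.2⟩) <|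
    ofReal_add_le_timeOn hτb unitInterval.le_one'
      (ofReal_mul_dist_le_timeOn hv γ.continuous hτb) <|
    ofReal_dist_le_timeOn γ.continuous unitInterval.le_one' fun u hu h => (hab u h).2.not_gt hu.1
  have h1 := hγ.le_of_ofReal_le hv key ha hb
  rw [γ.source, γ.target] at h1
  have hw := toReal_inv_lt_one hv
  have hw0 : 0 ≤ (v⁻¹).toReal := ENNReal.toReal_nonneg
  have hpos : 0 < dist (γ c) (γ s) := dist_pos.2 fun h => hsH (h ▸ hc_mem)
  have htri : dist (γ a) (γ b) ≤ dist (γ a) (γ c) + (dist (γ c) (γ s) + dist (γ s) (γ τ)) +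
      dist (γ τ) (γ b) := by
    linarith [dist_triangle (γ a) (γ c) (γ b), dist_triangle (γ c) (γ s) (γ b),
      dist_triangle (γ s) (γ τ) (γ b)]
  have h2 := mul_le_mul_of_nonneg_left htri hw0
  -- What is saved by replacing the excursion with travel at highway speed.
  have h3 : 0 < (1 - (v⁻¹).toReal) * (dist (γ c) (γ s) + dist (γ s) (γ τ)) :=
    mul_pos (by linarith) (by positivity)
  linarith

/-- Where a shortest time-path that uses the highway enters it, the point of entry and the
last point on the highway are optimal, seen from any earlier point of the path. -/
theorem IsShortestTimePath.exists_exit (hv : 1 < v) {q q' : LpPlane p} {γ : Path q q'}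
    (hγ : IsShortestTimePath v γ) (hu : UsesHighway γ) {τ : I} (hτ : IsEntryTime γ τ) :
    ∃ F ∈ highway p, ((v⁻¹).toReal ≠ 0 → F ≠ γ τ) ∧
      ENNReal.ofReal (dist q (γ τ) + (v⁻¹).toReal * dist (γ τ) F + dist F q') ≤ travelTime v γ ∧
      (∀ t ≤ τ, dist q (γ t) + dist (γ t) (γ τ) ≤ dist q (γ τ)) ∧
      ∀ t ≤ τ, ∀ E' ∈ highway p, ∀ F' ∈ highway p,
        dist (γ t) (γ τ) + (v⁻¹).toReal * dist (γ τ) F + dist F q' ≤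
          dist (γ t) E' + (v⁻¹).toReal * dist E' F' + dist F' q' := by
  have hlt := hγ.notMem_of_lt_entry hv hτ
  obtain ⟨a, b, ha, hb, hab⟩ := exists_first_last_hit γ ⟨τ, hτ.1⟩
  obtain rfl : a = τ := le_antisymm (hab τ hτ.1).1 (le_of_not_gt fun h => hlt a h ha)
  have hw0 : 0 ≤ (v⁻¹).toReal := ENNReal.toReal_nonneg
  have hfirst : ∀ s t, t ≤ a → s ≤ t →
      ENNReal.ofReal (dist (γ s) (γ t)) ≤ timeOn v γ (Icc s t) := fun s t ht hst =>
    ofReal_dist_le_timeOn γ.continuous hst fun u hu => hlt u (hu.2.trans_le ht)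
  have hlast : ENNReal.ofReal (dist (γ b) (γ 1)) ≤ timeOn v γ (Icc b 1) :=
    ofReal_dist_le_timeOn γ.continuous unitInterval.le_one' fun u hu h => (hab u h).2.not_gt hu.1
  have hmid := ofReal_add_le_timeOn (hab a ha).2 unitInterval.le_one'
    (ofReal_mul_dist_le_timeOn hv γ.continuous (hab a ha).2) hlast
  have key : ∀ t ≤ a, ENNReal.ofReal (dist (γ 0) (γ t) + (dist (γ t) (γ a) +
      ((v⁻¹).toReal * dist (γ a) (γ b) + dist (γ b) (γ 1)))) ≤ timeOn v γ (Icc 0 1) := fun t ht =>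
    ofReal_add_le_timeOn unitInterval.nonneg' unitInterval.le_one'
      (hfirst 0 t ht unitInterval.nonneg') <|
    ofReal_add_le_timeOn ht unitInterval.le_one' (hfirst t a le_rfl ht) hmid
  have key' := fun t ht E' hE' F' hF' =>
    hγ.le_of_ofReal_le hv (key t ht) (E := E') hE' (F := F') hF'
  rw [γ.source, γ.target] at key'
  refine ⟨γ b, hb, fun hw hba => ?_, ?_, fun t ht => ?_, fun t ht E' hE' F' hF' => ?_⟩
  -- If the first and last highway points coincide, visiting a different one in between is a round
  -- trip of positive cost that could be dropped.
  · obtain ⟨t, htH, hta⟩ := hu.exists_ne (γ a)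
    have h1 := hγ.le_of_ofReal_le hv (ofReal_add_le_timeOn unitInterval.nonneg'
      unitInterval.le_one' (hfirst 0 a le_rfl unitInterval.nonneg')
      (ofReal_add_le_timeOn (hab t htH).1 unitInterval.le_one'
        (ofReal_mul_dist_le_timeOn hv γ.continuous (hab t htH).1) <|
      ofReal_add_le_timeOn (hab t htH).2 unitInterval.le_one'
        (ofReal_mul_dist_le_timeOn hv γ.continuous (hab t htH).2) hlast)) ha hb
    rw [γ.source, γ.target, hba, dist_self, dist_comm (γ a)] at h1
    have := mul_pos (hw0.lt_of_ne' hw) (dist_pos.2 hta)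
    linarith
  · have := key a le_rfl
    rw [dist_self, zero_add, γ.source, γ.target, ← travelTime_eq_timeOn, ← add_assoc] at this
    exact this
  · have := key' t ht _ ha _ hb
    linarith
  · have := key' t ht E' hE' F' hF'
    -- A competitor from `γ t` gives one from `q`; the common term `dist q (γ t)` cancels.
    linarith [dist_triangle q (γ t) E']

end Bounds

/-! ### From constant slope to a straight arrival -/

section Straight

variable {p : ℝ≥0∞} [Fact (1 ≤ p)] {v : ℝ≥0∞}

theorem exists_isEntryTime {p : ℝ≥0∞} {q q' : LpPlane p} {γ : Path q q'} (hu : UsesHighway γ)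
    (hq : q ∉ highway p) : ∃ τ, IsEntryTime γ τ := by
  obtain ⟨t, ht, -⟩ := hu.exists_ne q
  obtain ⟨a, b, ha, -, hab⟩ := exists_first_last_hit γ ⟨t, ht⟩
  refine ⟨a, ha, 0, ?_, fun t ht h => (hab t h).1.not_gt ht.2⟩
  refine lt_of_le_of_ne unitInterval.nonneg' fun h => hq ?_
  rw [← h, γ.source] at ha
  exact ha

theorem IsEntryTime.pos {p : ℝ≥0∞} {q q' : LpPlane p} {γ : Path q q'} {τ : I}
    (hτ : IsEntryTime γ τ) : 0 < τ := by
  obtain ⟨-, s, hs, -⟩ := hτ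
  exact lt_of_le_of_lt unitInterval.nonneg' hs

theorem angleToNormal_eq_arctan {p : ℝ≥0∞} {P E : LpPlane p} {k : ℝ} (hP : P ∉ highway p)
    (hE : E ∈ highway p) (h : E 0 - P 0 = k * |P 1|) : angleToNormal P E = Real.arctan k := by
  rw [angleToNormal, h, mem_highway.1 hE, zero_sub, abs_neg,
    mul_div_cancel_right₀ _ (abs_ne_zero.2 hP)]

/-- The ratio `g` of the heights of `γ t` and `q` cannot change sign before `τ`, so the slope
condition places `γ t` on the line through `γ τ` and `q` at parameter `g t`. The distance bound
gives `g t ≤ 1`, and continuity makes `g` reach all of `[0, 1]`. -/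
theorem image_Iic_eq_segment_of_slope {q q' : LpPlane p} {γ : Path q q'} {τ : I} {k : ℝ}
    (hτ : IsEntryTime γ τ) (hlt : ∀ t < τ, γ t ∉ highway p)
    (hd : ∀ t ≤ τ, dist (γ t) (γ τ) ≤ dist q (γ τ))
    (hk : ∀ t < τ, γ τ 0 - γ t 0 = k * |γ t 1|) : γ '' Iic τ = segment ℝ q (γ τ) := by
  have hE : γ τ 1 = 0 := hτ.1
  have hq : q 1 ≠ 0 := by simpa [mem_highway] using hlt 0 hτ.pos
  have hk0 : γ τ 0 - q 0 = k * |q 1| := by simpa using hk 0 hτ.pos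
  let g : I → ℝ := fun t => γ t 1 / q 1
  have hg : Continuous g :=
    ((PiLp.continuous_apply p (fun _ : Fin 2 => ℝ) 1).comp γ.continuous).div_const _
  have hg0 : g 0 = 1 := by simp [g, hq]
  have hgτ : g τ = 0 := by simp [g, hE]
  have hgpos : ∀ t < τ, 0 < g t := fun t ht => by
    by_contra! hneg
    obtain ⟨u, hu, hu0⟩ := intermediate_value_Icc' (unitInterval.nonneg' (t := t))
      hg.continuousOn ⟨hneg, by rw [hg0]; exact zero_le_one⟩
    exact hlt u (hu.2.trans_lt ht) ((div_eq_zero_iff.1 hu0).resolve_right hq)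
  have hline : ∀ t ≤ τ, γ t = AffineMap.lineMap (γ τ) q (g t) := fun t ht => by
    have h1 : γ t 1 = g t * q 1 := (div_mul_cancel₀ _ hq).symm
    have h0 : γ τ 0 - γ t 0 = k * |γ t 1| := by
      obtain rfl | h := ht.eq_or_lt
      · simp [hE]
      · exact hk t h
    have hgn : 0 ≤ g t := by
      obtain rfl | h := ht.eq_or_lt
      · exact hgτ.ge
      · exact (hgpos t h).le
    rw [h1, abs_mul, abs_of_nonneg hgn] at h0
    ext i
    fin_cases i
    · simp only [AffineMap.lineMap_apply, Fin.zero_eta, vsub_eq_sub, vadd_eq_add, PiLp.add_apply,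
        PiLp.smul_apply, PiLp.sub_apply, smul_eq_mul]
      linear_combination -h0 + g t * hk0
    · simp only [AffineMap.lineMap_apply, Fin.mk_one, vsub_eq_sub, vadd_eq_add, PiLp.add_apply,
        PiLp.smul_apply, PiLp.sub_apply, smul_eq_mul, hE, h1]
      ring
  rw [segment_symm, segment_eq_image_lineMap]
  refine Subset.antisymm ?_ ?_
  · rintro _ ⟨t, ht, rfl⟩
    have hgn : 0 ≤ g t := by
      obtain rfl | h := (show t ≤ τ from ht).eq_or_lt
      · exact hgτ.ge
      · exact (hgpos t h).le
    refine ⟨g t, ⟨hgn, ?_⟩, (hline t ht).symm⟩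
    have h := hd t ht
    rw [hline t ht, dist_lineMap_left, Real.norm_of_nonneg hgn, dist_comm] at h
    have hpos : 0 < dist q (γ τ) := dist_pos.2 fun h => hq (h ▸ hE)
    exact le_of_mul_le_mul_right (by simpa using h) hpos
  · rintro _ ⟨s, hs, rfl⟩
    obtain ⟨t, ht, rfl⟩ := intermediate_value_Icc' (unitInterval.nonneg' (t := τ))
      hg.continuousOn (by rwa [hg0, hgτ])
    exact ⟨t, ht.2, hline t ht.2⟩

theorem IsShortestTimePath.entersWithAngle_of_slope (hv : 1 < v) {q q' : LpPlane p}
    {γ : Path q q'} (hγ : IsShortestTimePath v γ) (hu : UsesHighway γ) {k : ℝ}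
    (hk : ∀ τ, IsEntryTime γ τ → ∀ t < τ, γ τ 0 - γ t 0 = k * |γ t 1|) :
    EntersWithAngle γ (Real.arctan k) := by
  refine ⟨exists_isEntryTime hu, fun τ hτ => ?_⟩
  have hlt := hγ.notMem_of_lt_entry hv hτ
  obtain ⟨F, -, -, -, hd, -⟩ := hγ.exists_exit hv hu hτ
  refine ⟨image_Iic_eq_segment_of_slope hτ hlt
    (fun t ht => (le_add_of_nonneg_left dist_nonneg).trans (hd t ht)) (hk τ hτ), ?_⟩
  refine tendsto_const_nhds.congr' ?_
  filter_upwards [self_mem_nhdsWithin] with t ht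
  exact (angleToNormal_eq_arctan (hlt t ht) hτ.1 (hk τ hτ t ht)).symm

end Straight

/-! ### The one-variable minimisation problem for the entry abscissa -/

section Optimal

variable {p : ℝ≥0∞} [Fact (1 ≤ p)] {w e f : ℝ} {P : LpPlane p}

/-- If `P 0` and `f` were strictly on the same side of `e`, moving `e` towards both would shorten
the highway part without lengthening the approach. -/
theorem sub_mul_sub_nonneg_of_optimal (hw : 0 < w)
    (h : ∀ x, dist P (highwayPoint p e) + w * |e - f| ≤ dist P (highwayPoint p x) + w * |x - f|) :
    0 ≤ (e - P 0) * (f - e) := by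
  by_contra! hneg
  have hfe : f - e ≠ 0 := fun h0 => by simp [h0] at hneg
  have hr : 0 < (P 0 - e) / (f - e) := by
    rw [← mul_div_mul_right _ _ hfe]
    exact div_pos (by linarith) (mul_self_pos.2 hfe)
  set r := (P 0 - e) / (f - e) with hrdef
  have hre : P 0 - e = r * (f - e) := (div_mul_cancel₀ _ hfe).symm
  -- The fraction `min 1 r` of the way from `e` to `f` stops at the nearer of `f` and `P 0`.
  have hs : 0 < min 1 r := lt_min one_pos hr
  have h1 := h (e + min 1 r * (f - e))
  have h2 : dist P (highwayPoint p (e + min 1 r * (f - e))) ≤ dist P (highwayPoint p e) := by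
    refine dist_le_dist_of_abs_le ?_ le_rfl
    have : P 0 - (e + min 1 r * (f - e)) = (r - min 1 r) * (f - e) := by linarith
    rw [highwayPoint_zero, highwayPoint_zero, this, hre, abs_mul, abs_mul,
      abs_of_nonneg (sub_nonneg.2 (min_le_right _ _)), abs_of_pos hr]
    gcongr
    linarith
  have h3 : |e + min 1 r * (f - e) - f| = (1 - min 1 r) * |e - f| := by
    have : e + min 1 r * (f - e) - f = (1 - min 1 r) * (e - f) := by ring
    rw [this, abs_mul, abs_of_nonneg (sub_nonneg.2 (min_le_left _ _))]
  have h4 : 0 < w * (min 1 r * |e - f|) :=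
    mul_pos hw (mul_pos hs (abs_pos.2 fun h => hfe (by linarith)))
  rw [h3] at h1
  linarith

/-- Moving to the foot of `P` saves `|P 0 - e|` and costs at most `w` times as much. -/
theorem eq_of_optimal_one {P : LpPlane 1} (hw : w < 1)
    (h : ∀ x, dist P (highwayPoint 1 e) + w * |e - f| ≤ dist P (highwayPoint 1 x) + w * |x - f|)
    (hw0 : 0 ≤ w) : e = P 0 := by
  have h1 := h (P 0)
  rw [dist_one_eq_add, dist_one_eq_add] at h1
  simp only [highwayPoint_zero, highwayPoint_one, sub_self, abs_zero] at h1
  have h2 := mul_le_mul_of_nonneg_left (abs_sub_le (P 0) e f) hw0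
  have h3 : (1 - w) * |P 0 - e| ≤ 0 := by linarith
  have h4 : |P 0 - e| ≤ 0 := nonpos_of_mul_nonpos_right h3 (by linarith)
  linarith [abs_nonpos_iff.1 h4]

theorem eq_of_dist_le (hp : p ≠ ∞) (h : dist P (highwayPoint p e) ≤ |P 1|) : e = P 0 := by
  have hr : 0 < p.toReal := ENNReal.toReal_pos (zero_lt_one.trans_le Fact.out).ne' hp
  rw [dist_eq_rpow hp, one_div] at h
  simp only [highwayPoint_zero, highwayPoint_one, sub_zero] at h
  rw [Real.rpow_inv_le_iff_of_pos (by positivity) (abs_nonneg _) hr] at h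
  have h1 : |P 0 - e| ^ p.toReal = 0 := le_antisymm (by linarith) (by positivity)
  have h2 := (Real.rpow_eq_zero (abs_nonneg _) hr.ne').1 h1
  linarith [abs_eq_zero.1 h2]

/-- An offset larger than the height can be reduced, saving at rate `1` and paying at rate at most
`w < 1`. While the offset is smaller than the height, moving towards `f` leaves the approach cost
unchanged and saves at rate `w`. -/
theorem slope_of_optimal_top {P : LpPlane ∞} (hw : 0 < w) (hw1 : w < 1) (hef : e ≠ f)
    (h : ∀ x, dist P (highwayPoint ∞ e) + w * |e - f| ≤ dist P (highwayPoint ∞ x) + w * |x - f|) :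
    e - P 0 = SignType.sign (f - e) * |P 1| := by
  have hs := sub_mul_sub_nonneg_of_optimal hw h
  simp only [dist_eq_max, highwayPoint_zero, highwayPoint_one, sub_zero] at h
  obtain hef | hef := hef.lt_or_gt
  · have he : 0 ≤ e - P 0 := nonneg_of_mul_nonneg_left hs (by linarith)
    rw [sign_pos (by linarith), SignType.coe_one, one_mul]
    refine le_antisymm ?_ ?_ <;> by_contra! hlt
    · have h1 := h (P 0 + |P 1|)
      rw [abs_of_neg (by linarith : e - f < 0), abs_of_neg (by linarith : P 0 + |P 1| - f < 0),
        sub_add_cancel_left, abs_neg, abs_abs, max_self] at h1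
      have h2 := le_max_left |P 0 - e| |P 1|
      rw [abs_sub_comm, abs_of_nonneg he] at h1 h2
      nlinarith
    · have h1 := h (min f (P 0 + |P 1|))
      have h2 : e < min f (P 0 + |P 1|) := lt_min hef (by linarith)
      have h3 := min_le_left f (P 0 + |P 1|)
      have h4 := min_le_right f (P 0 + |P 1|)
      rw [abs_of_neg (by linarith : e - f < 0), abs_of_nonpos (by linarith : _ - f ≤ 0),
        max_eq_right (abs_le.2 ⟨by linarith, by linarith⟩),
        max_eq_right (abs_le.2 ⟨by linarith, by linarith⟩)] at h1
      nlinarith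
  · have he : e - P 0 ≤ 0 := nonpos_of_mul_nonneg_left hs (by linarith)
    rw [sign_neg (by linarith), SignType.coe_neg_one, neg_one_mul]
    refine le_antisymm ?_ ?_ <;> by_contra! hlt
    · have h1 := h (max f (P 0 - |P 1|))
      have h2 : max f (P 0 - |P 1|) < e := max_lt hef (by linarith)
      have h3 := le_max_left f (P 0 - |P 1|)
      have h4 := le_max_right f (P 0 - |P 1|)
      rw [abs_of_pos (by linarith : 0 < e - f), abs_of_nonneg (by linarith : 0 ≤ _ - f),
        max_eq_right (abs_le.2 ⟨by linarith, by linarith⟩),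
        max_eq_right (abs_le.2 ⟨by linarith, by linarith⟩)] at h1
      nlinarith
    · have h1 := h (P 0 - |P 1|)
      rw [abs_of_pos (by linarith : 0 < e - f), abs_of_pos (by linarith : 0 < P 0 - |P 1| - f),
        sub_sub_cancel, abs_abs, max_self] at h1
      have h2 := le_max_left |P 0 - e| |P 1|
      rw [abs_of_nonneg (by linarith)] at h1 h2
      nlinarith

/-- Raising the critical equation to the power `r / (r - 1)` turns it into `w ^ (r / (r - 1)) = x ^
r / (x ^ r + y ^ r)`, which is linear in `x ^ r`. -/
theorem eq_mul_of_critical {r x y : ℝ} (hr : 1 < r) (hw : 0 < w) (hw1 : w < 1) (hx : 0 < x)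
    (hy : 0 < y) (h : x ^ (r - 1) * (x ^ r + y ^ r) ^ (1 / r - 1) = w) :
    x = w ^ (1 / (r - 1)) / (1 - w ^ (r / (r - 1))) ^ (1 / r) * y := by
  have hr1 : r - 1 ≠ 0 := by linarith
  have hr0 : r ≠ 0 := by linarith
  have hN : 0 < x ^ r + y ^ r := by positivity
  have hc1 : 0 < 1 - w ^ (r / (r - 1)) := by
    have : w ^ (r / (r - 1)) < 1 :=
      Real.rpow_lt_one hw.le hw1 (div_pos (by linarith) (by linarith))
    linarith
  have h1 : w ^ (r / (r - 1)) = x ^ r / (x ^ r + y ^ r) := by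
    rw [← h, Real.mul_rpow (by positivity) (by positivity), ← Real.rpow_mul hx.le,
      ← Real.rpow_mul hN.le, mul_div_cancel₀ _ hr1]
    have : (1 / r - 1) * (r / (r - 1)) = -1 := by field_simp; ring
    rw [this, Real.rpow_neg_one, div_eq_mul_inv]
  have h2 : x ^ r * (1 - w ^ (r / (r - 1))) = w ^ (r / (r - 1)) * y ^ r := by
    rw [h1]; field_simp; ring
  have h3 : (x ^ r * (1 - w ^ (r / (r - 1)))) ^ (1 / r) =
      (w ^ (r / (r - 1)) * y ^ r) ^ (1 / r) := by rw [h2]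
  rw [Real.mul_rpow (by positivity) hc1.le, Real.mul_rpow (by positivity) (by positivity),
    ← Real.rpow_mul hx.le, ← Real.rpow_mul hy.le, ← Real.rpow_mul hw.le,
    mul_one_div_cancel hr0, Real.rpow_one, Real.rpow_one] at h3
  have h4 : r / (r - 1) * (1 / r) = 1 / (r - 1) := by field_simp
  rw [h4] at h3
  have h5 : 0 < (1 - w ^ (r / (r - 1))) ^ (1 / r) := by positivity
  rw [div_mul_eq_mul_div, eq_div_iff h5.ne', h3]

/-- The objective is differentiable at `e`: `r > 1` smooths the approach term, and `e ≠ f` avoids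
the corner of `|x - f|`. The vanishing derivative fixes both the sign and the size of the offset. -/
theorem slope_of_optimal (hp : p ≠ ∞) (hp1 : p ≠ 1) (hw : 0 < w) (hw1 : w < 1) (hef : e ≠ f)
    (hP : P 1 ≠ 0)
    (h : ∀ x, dist P (highwayPoint p e) + w * |e - f| ≤ dist P (highwayPoint p x) + w * |x - f|) :
    e - P 0 = SignType.sign (f - e) * (w ^ (1 / (p.toReal - 1)) /
      (1 - w ^ (p.toReal / (p.toReal - 1))) ^ (1 / p.toReal)) * |P 1| := by
  have hr : 1 < p.toReal := by
    have := lt_of_le_of_ne (Fact.out : 1 ≤ p) hp1.symm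
    simpa using ENNReal.toReal_strict_mono hp this
  simp only [dist_eq_rpow hp, highwayPoint_zero, highwayPoint_one, sub_zero] at h
  set r := p.toReal
  have hy : 0 < |P 1| := abs_pos.2 hP
  have hN : 0 < |e - P 0| ^ r + |P 1| ^ r := by positivity
  have hd1 : HasDerivAt (fun x => |x - P 0| ^ r) (r * |e - P 0| ^ (r - 2) * (e - P 0)) e :=
    (hasDerivAt_abs_rpow (e - P 0) hr).comp_sub_const e (P 0)
  have hd2 := (hd1.add_const (|P 1| ^ r)).rpow_const (p := 1 / r) (Or.inl hN.ne')
  have hd3 : HasDerivAt (fun x => |x - f|) (SignType.sign (e - f) : ℝ) e :=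
    (hasDerivAt_abs (sub_ne_zero.2 hef)).comp_sub_const e f
  have hmin : IsLocalMin (fun x => (|x - P 0| ^ r + |P 1| ^ r) ^ (1 / r) + w * |x - f|) e :=
    Eventually.of_forall fun x => by
      simpa only [abs_sub_comm _ (P 0)] using h x
  have hcrit := hmin.hasDerivAt_eq_zero (hd2.add (hd3.const_mul w))
  have hsgn : (SignType.sign (e - f) : ℝ) = -SignType.sign (f - e) := by
    rw [← neg_sub f e, Left.sign_neg, SignType.coe_neg]
  have hcrit' : |e - P 0| ^ (r - 2) * (e - P 0) * (|e - P 0| ^ r + |P 1| ^ r) ^ (1 / r - 1) =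
      w * SignType.sign (f - e) := by
    rw [hsgn] at hcrit
    have : r * (1 / r) = 1 := mul_one_div_cancel (by linarith)
    linear_combination hcrit - |e - P 0| ^ (r - 2) * (e - P 0) *
      (|e - P 0| ^ r + |P 1| ^ r) ^ (1 / r - 1) * this
  have hpow : ∀ x : ℝ, 0 < x → x ^ (r - 2) * x = x ^ (r - 1) := fun x hx => by
    rw [← Real.rpow_add_one hx.ne']; ring_nf
  have hx0 : e - P 0 ≠ 0 := fun h0 => by
    have : (SignType.sign (f - e) : ℝ) = 0 := by
      simpa [h0, hw.ne'] using hcrit'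
    obtain hlt | hlt := hef.lt_or_gt
    · rw [sign_pos (by linarith), SignType.coe_one] at this
      linarith
    · rw [sign_neg (by linarith), SignType.coe_neg_one] at this
      linarith
  obtain hlt | hlt := hef.lt_or_gt
  · rw [sign_pos (by linarith), SignType.coe_one] at hcrit' ⊢
    have hx : 0 < e - P 0 := by
      refine hx0.lt_or_gt.resolve_left fun hneg => ?_
      have : |e - P 0| ^ (r - 2) * (e - P 0) * (|e - P 0| ^ r + |P 1| ^ r) ^ (1 / r - 1) ≤ 0 :=
        mul_nonpos_of_nonpos_of_nonneg
          (mul_nonpos_of_nonneg_of_nonpos (by positivity) hneg.le) (by positivity)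
      linarith
    rw [abs_of_pos hx, hpow _ hx, mul_one] at hcrit'
    rw [one_mul]
    exact eq_mul_of_critical hr hw hw1 hx hy hcrit'
  · rw [sign_neg (by linarith), SignType.coe_neg_one] at hcrit' ⊢
    have hx : e - P 0 < 0 := by
      refine hx0.lt_or_gt.resolve_right fun hpos => ?_
      have : 0 ≤ |e - P 0| ^ (r - 2) * (e - P 0) * (|e - P 0| ^ r + |P 1| ^ r) ^ (1 / r - 1) := by
        positivity
      linarith
    have hx' : 0 < -(e - P 0) := by linarith
    have hcrit'' : (-(e - P 0)) ^ (r - 1) * ((-(e - P 0)) ^ r + |P 1| ^ r) ^ (1 / r - 1) = w := by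
      rw [← hpow _ hx', ← abs_of_neg hx]
      rw [abs_of_neg hx] at hcrit' ⊢
      linear_combination -hcrit'
    have := eq_mul_of_critical hr hw hw1 hx' hy hcrit''
    linear_combination -this

end Optimal

/-! ### Incidence angles for `p < ∞`, and for `p = ∞` with `v < ∞` -/

section Incidence

variable {p : ℝ≥0∞} [Fact (1 ≤ p)] {v : ℝ≥0∞}

theorem eq_highwayPoint {p : ℝ≥0∞} {E : LpPlane p} (hE : E ∈ highway p) :
    E = highwayPoint p (E 0) := by
  ext i
  fin_cases i
  · rfl
  · exact hE

theorem sign_eq_sign_of_mul_pos {a b : ℝ} (h : 0 < a * b) : SignType.sign a = SignType.sign b := by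
  obtain ⟨ha, hb⟩ | ⟨ha, hb⟩ := mul_pos_iff.1 h
  · rw [sign_pos ha, sign_pos hb]
  · rw [sign_neg ha, sign_neg hb]

theorem arctan_sign_mul (s : SignType) (x : ℝ) : Real.arctan (s * x) = s * Real.arctan x := by
  cases s <;> simp

theorem toReal_inv_pos (hv : 1 < v) (hv' : v ≠ ∞) : 0 < (v⁻¹).toReal :=
  ENNReal.toReal_pos (ENNReal.inv_ne_zero.2 hv') (ENNReal.inv_ne_top.2 (zero_lt_one.trans hv).ne')

theorem IsShortestTimePath.exists_exit_abscissa (hv : 1 < v) {q q' : LpPlane p} {γ : Path q q'}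
    (hγ : IsShortestTimePath v γ) (hu : UsesHighway γ) {τ : I} (hτ : IsEntryTime γ τ) :
    ∃ f : ℝ, (v ≠ ∞ → γ τ 0 ≠ f ∧ SignType.sign (f - γ τ 0) = SignType.sign (q' 0 - q 0)) ∧
      ∀ t ≤ τ, ∀ x, dist (γ t) (highwayPoint p (γ τ 0)) + (v⁻¹).toReal * |γ τ 0 - f| ≤
        dist (γ t) (highwayPoint p x) + (v⁻¹).toReal * |x - f| := by
  obtain ⟨F, hF, hne, -, -, hopt⟩ := hγ.exists_exit hv hu hτ
  have hE := eq_highwayPoint hτ.1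
  have hF' := eq_highwayPoint hF
  have hentry : ∀ t ≤ τ, ∀ x, dist (γ t) (highwayPoint p (γ τ 0)) +
      (v⁻¹).toReal * |γ τ 0 - F 0| ≤
        dist (γ t) (highwayPoint p x) + (v⁻¹).toReal * |x - F 0| := fun t ht x => by
    have h := hopt t ht _ (highwayPoint_mem x) _ hF
    rw [dist_of_mem_highway hτ.1 hF, dist_of_mem_highway (highwayPoint_mem x) hF] at h
    rw [← hE]
    simp only [highwayPoint_zero] at h
    linarith
  refine ⟨F 0, fun hv' => ?_, hentry⟩
  have hw := toReal_inv_pos hv hv'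
  have hne' : γ τ 0 ≠ F 0 := fun h => hne hw.ne' (by rw [hF', hE, h])
  have h1 := sub_mul_sub_nonneg_of_optimal hw (hentry 0 unitInterval.nonneg')
  -- The same argument seen from `q'`, with entry and exit exchanged. Together with `h1` it shows
  -- that `q 0`, `γ τ 0`, `F 0`, `q' 0` are in monotone order, which identifies the sign.
  have h2 := sub_mul_sub_nonneg_of_optimal (P := q') (e := F 0) (f := γ τ 0) hw fun x => by
    have h := hopt τ le_rfl _ hτ.1 _ (highwayPoint_mem x)
    rw [dist_of_mem_highway hτ.1 hF, dist_of_mem_highway hτ.1 (highwayPoint_mem x)] at h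
    rw [← hF', dist_comm q', dist_comm q', abs_sub_comm, abs_sub_comm x]
    simp only [highwayPoint_zero] at h
    linarith
  refine ⟨hne', sign_eq_sign_of_mul_pos ?_⟩
  have h3 : 0 < (F 0 - γ τ 0) * (F 0 - γ τ 0) := mul_self_pos.2 (sub_ne_zero.2 hne'.symm)
  rw [γ.source] at h1
  linarith

/-- Uses `arctan x = arcsin (x / √(1 + x ^ 2))` at the slope found in `slope_of_optimal`, with `w =
1/v` reversing the signs of the exponents. -/
theorem incidenceAngle_eq_arctan (hp : p ≠ ∞) (hp1 : p ≠ 1) (hv : 1 < v) (hv' : v ≠ ∞) :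
    incidenceAngle p v = Real.arctan ((v⁻¹).toReal ^ (1 / (p.toReal - 1)) /
      (1 - (v⁻¹).toReal ^ (p.toReal / (p.toReal - 1))) ^ (1 / p.toReal)) := by
  have hr : 1 < p.toReal := by
    have := lt_of_le_of_ne (Fact.out : 1 ≤ p) hp1.symm
    simpa using ENNReal.toReal_strict_mono hp this
  have hw := toReal_inv_pos hv hv'
  have hw1 := toReal_inv_lt_one hv
  have hvw : v.toReal = ((v⁻¹).toReal)⁻¹ := by rw [ENNReal.toReal_inv, inv_inv]
  rw [incidenceAngle, if_neg (by tauto), Real.arctan_eq_arcsin, hvw]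
  set w := (v⁻¹).toReal
  set r := p.toReal
  have hr1 : r - 1 ≠ 0 := by linarith
  have hpow : ∀ c : ℝ, w⁻¹ ^ (c / (1 - r)) = w ^ (c / (r - 1)) := fun c => by
    rw [Real.inv_rpow hw.le, ← Real.rpow_neg hw.le, ← div_neg, neg_sub]
  have hc1 : 0 < 1 - w ^ (r / (r - 1)) := by
    have : w ^ (r / (r - 1)) < 1 :=
      Real.rpow_lt_one hw.le hw1 (div_pos (by linarith) (by linarith))
    linarith
  rw [hpow, hpow, hpow]
  have hA : w ^ (2 / (r - 1)) = (w ^ (1 / (r - 1))) ^ 2 := by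
    rw [← Real.rpow_natCast, ← Real.rpow_mul hw.le]
    congr 1
    push_cast
    ring
  have hB : (1 - w ^ (r / (r - 1))) ^ (2 / r) = ((1 - w ^ (r / (r - 1))) ^ (1 / r)) ^ 2 := by
    rw [← Real.rpow_natCast, ← Real.rpow_mul hc1.le]
    congr 1
    push_cast
    ring
  rw [hA, hB]
  have hBpos : 0 < (1 - w ^ (r / (r - 1))) ^ (1 / r) := by positivity
  set A := w ^ (1 / (r - 1))
  set B := (1 - w ^ (r / (r - 1))) ^ (1 / r)
  congr 1
  have h : 1 + (A / B) ^ 2 = (A ^ 2 + B ^ 2) / B ^ 2 := by field_simp; ring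
  rw [h, Real.sqrt_div (by positivity), Real.sqrt_sq hBpos.le,
    div_div_div_cancel_right₀ hBpos.ne']

theorem incidenceAngle_two (hv : 1 < v) : incidenceAngle 2 v = Real.arcsin (v⁻¹).toReal := by
  by_cases hv' : v = ∞
  · simp [incidenceAngle, hv']
  · have h2 : (2 : ℝ≥0∞) ≠ 1 := by norm_num
    have hpos : 0 < v.toReal := ENNReal.toReal_pos (zero_lt_one.trans hv).ne' hv'
    rw [incidenceAngle, if_neg (by tauto), ENNReal.toReal_ofNat, ENNReal.toReal_inv]
    norm_num [Real.rpow_neg_one]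

theorem IsShortestTimePath.entersWithAngle_incidenceAngle (hp : p ≠ ∞) (hv : 1 < v)
    {q q' : LpPlane p} {γ : Path q q'} (hγ : IsShortestTimePath v γ) (hu : UsesHighway γ) :
    EntersWithAngle γ (SignType.sign (q' 0 - q 0) * incidenceAngle p v) := by
  have hw1 := toReal_inv_lt_one hv
  by_cases h0 : p = 1 ∨ v = ∞
  · have hang : incidenceAngle p v = Real.arctan 0 := by
      rw [incidenceAngle, if_pos h0, Real.arctan_zero]
    rw [hang, ← arctan_sign_mul, mul_zero]
    refine hγ.entersWithAngle_of_slope hv hu fun τ hτ t ht => ?_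
    obtain ⟨f, -, hopt⟩ := hγ.exists_exit_abscissa hv hu hτ
    rw [zero_mul, sub_eq_zero]
    obtain rfl | rfl := h0
    · exact eq_of_optimal_one hw1 (hopt t ht.le) ENNReal.toReal_nonneg
    · refine eq_of_dist_le hp ?_
      have h := hopt t ht.le (γ t 0)
      rw [dist_of_fst_eq (P := γ t) (Q := highwayPoint p (γ t 0)) rfl] at h
      simpa using h
  · push Not at h0
    rw [incidenceAngle_eq_arctan hp h0.1 hv h0.2, ← arctan_sign_mul]
    refine hγ.entersWithAngle_of_slope hv hu fun τ hτ t ht => ?_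
    obtain ⟨f, hf, hopt⟩ := hγ.exists_exit_abscissa hv hu hτ
    obtain ⟨hne, hs⟩ := hf h0.2
    rw [← hs]
    exact slope_of_optimal hp h0.1 (toReal_inv_pos hv h0.2) hw1 hne
      (hγ.notMem_of_lt_entry hv hτ t ht) (hopt t ht.le)

theorem IsShortestTimePath.entersWithAngle_pi_div_four (hv : 1 < v) (hv' : v ≠ ∞)
    {q q' : LpPlane ∞} {γ : Path q q'} (hγ : IsShortestTimePath v γ) (hu : UsesHighway γ) :
    EntersWithAngle γ (SignType.sign (q' 0 - q 0) * (Real.pi / 4)) := by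
  rw [← Real.arctan_one, ← arctan_sign_mul, mul_one]
  refine hγ.entersWithAngle_of_slope hv hu fun τ hτ t ht => ?_
  obtain ⟨f, hf, hopt⟩ := hγ.exists_exit_abscissa hv hu hτ
  obtain ⟨hne, hs⟩ := hf hv'
  rw [← hs]
  exact slope_of_optimal_top (toReal_inv_pos hv hv') (toReal_inv_lt_one hv) hne (hopt t ht.le)

end Incidence

/-! ### The case `p = v = ∞` -/

section InfiniteSpeed

/-- Travel on the highway is free, so comparison with the foot of `γ t` bounds the horizontal offset
by the height. -/
theorem IsShortestTimePath.angleToNormal_mem {q q' : LpPlane ∞} {γ : Path q q'}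
    (hγ : IsShortestTimePath ∞ γ) (hu : UsesHighway γ) {τ : I} (hτ : IsEntryTime γ τ) {t : I}
    (ht : t < τ) : angleToNormal (γ t) (γ τ) ∈ Icc (-(Real.pi / 4)) (Real.pi / 4) := by
  have hv : (1 : ℝ≥0∞) < ∞ := ENNReal.one_lt_top
  have hP : γ t 1 ≠ 0 := hγ.notMem_of_lt_entry hv hτ t ht
  obtain ⟨f, -, hopt⟩ := hγ.exists_exit_abscissa hv hu hτ
  have h := hopt t ht.le (γ t 0)
  rw [dist_of_fst_eq (P := γ t) (Q := highwayPoint ∞ (γ t 0)) rfl, dist_eq_max] at h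
  simp only [highwayPoint_zero, highwayPoint_one, sub_zero, ENNReal.inv_top, ENNReal.toReal_zero,
    zero_mul, add_zero, max_le_iff] at h
  have hb := abs_le.1 h.1
  have hy : 0 < |γ t 1| := abs_pos.2 hP
  rw [angleToNormal, mem_highway.1 hτ.1, zero_sub, abs_neg, ← Real.arctan_one, ← Real.arctan_neg]
  refine ⟨Real.arctan_mono ?_, Real.arctan_mono ?_⟩
  · rw [le_div_iff₀ hy]; linarith
  · rw [div_le_iff₀ hy]; linarith

theorem IsShortestTimePath.exists_entersWithAngle {q q' : LpPlane ∞} {γ : Path q q'}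
    (hγ : IsShortestTimePath ∞ γ) (hu : UsesHighway γ) (hq : q ∉ highway ∞) {θ : ℝ}
    (hθ : θ ∈ Icc (-(Real.pi / 4)) (Real.pi / 4)) :
    ∃ γ' : Path q q', IsShortestTimePath ∞ γ' ∧ UsesHighway γ' ∧ EntersWithAngle γ' θ := by
  have hv : (1 : ℝ≥0∞) < ∞ := ENNReal.one_lt_top
  have hpi := Real.pi_pos
  have hθk : Real.arctan (Real.tan θ) = θ := Real.arctan_tan (by linarith [hθ.1]) (by linarith [hθ.2])
  set k := Real.tan θ
  have hk : |k| ≤ 1 := by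
    rw [abs_le, ← Real.arctan_le_arctan_iff, ← Real.arctan_le_arctan_iff (x := k), Real.arctan_neg,
      Real.arctan_one, hθk]
    exact hθ
  set e := q 0 + k * |q 1|
  let E : LpPlane ∞ := highwayPoint ∞ e
  -- A free detour of unit length, so that the path uses the highway even if `E` is already the foot
  -- of `q'`.
  let G : LpPlane ∞ := highwayPoint ∞ (e + 1)
  let F : LpPlane ∞ := highwayPoint ∞ (q' 0)
  let γ' : Path q q' := (Path.segment q E).trans ((Path.segment E G).trans (viaPath G G F q'))
  have hqE : dist q E = |q 1| := by
    have h0 : q 0 - E 0 = -(k * |q 1|) := by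
      change q 0 - e = _
      simp [e]
    have h1 : q 1 - E 1 = q 1 := sub_zero _
    rw [dist_eq_max, h0, h1, abs_neg, abs_mul, abs_abs, max_eq_right]
    exact mul_le_of_le_one_left (abs_nonneg _) hk
  have hFq : dist F q' = |q' 1| := by
    rw [dist_comm, dist_of_fst_eq (P := q') (Q := F) rfl]
    change |q' 1 - 0| = _
    rw [sub_zero]
  have hT : travelTime ∞ γ' ≤ ENNReal.ofReal (|q 1| + |q' 1|) := by
    have h1 : travelTime ∞ (Path.segment q E) ≤ ENNReal.ofReal |q 1| := by
      rw [← hqE, ← edist_dist]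
      exact travelTime_segment_le hv.le (Or.inr (highwayPoint_mem _))
    have h2 : travelTime ∞ (Path.segment E G) ≤ 0 :=
      (travelTime_segment_highway_le (highwayPoint_mem _) (highwayPoint_mem _)).trans (by simp)
    have h3 : travelTime ∞ (viaPath G G F q') ≤ ENNReal.ofReal |q' 1| := by
      refine (travelTime_viaPath_le hv G q' (highwayPoint_mem _) (highwayPoint_mem _)).trans ?_
      rw [dist_self, hFq]
      simp
    rw [ENNReal.ofReal_add (abs_nonneg _) (abs_nonneg _)]
    refine (travelTime_trans_le _ _).trans (add_le_add h1 ((travelTime_trans_le _ _).trans ?_))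
    simpa using add_le_add h2 h3
  -- The given shortest path `γ` meets the highway, so it already needs time at least `|q 1| + |q'
  -- 1|`.
  have hγ' : IsShortestTimePath ∞ γ' := fun δ => by
    obtain ⟨τ, hτ⟩ := exists_isEntryTime hu hq
    obtain ⟨F', hF', -, hlow, -⟩ := hγ.exists_exit hv hu hτ
    refine hT.trans (le_trans (ENNReal.ofReal_le_ofReal ?_) (hlow.trans (hγ δ)))
    have h1 := abs_sub_le_dist q (γ τ) 1
    have h2 := abs_sub_le_dist F' q' 1
    rw [mem_highway.1 hτ.1, sub_zero] at h1
    rw [mem_highway.1 hF', zero_sub, abs_neg] at h2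
    simpa using add_le_add h1 h2
  have hu' : UsesHighway γ' := by
    refine ⟨E, G, fun h => ?_, subset_inter ?_ ?_⟩
    · have : e = e + 1 := congrArg (fun P : LpPlane ∞ => P 0) h
      linarith
    · rw [Path.trans_range, Path.trans_range, Path.range_segment, Path.range_segment]
      exact subset_union_left.trans subset_union_right
    · rw [segment_eq_image_lineMap]
      rintro _ ⟨s, -, rfl⟩
      simp [mem_highway, AffineMap.lineMap_apply, E, G]
  refine ⟨γ', hγ', hu', ?_⟩
  rw [← hθk]
  refine hγ'.entersWithAngle_of_slope hv hu' fun τ hτ t ht => ?_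
  have hcoord : ∀ s : I, (s : ℝ) ≤ 1 / 2 → ∀ i, γ' s i = q i + 2 * s * (E i - q i) :=
    fun s hs i => by
      simp only [γ']
      rw [Path.trans_apply, dif_pos hs, segment_apply_coord]
  let m : I := ⟨1 / 2, by norm_num, by norm_num⟩
  have hE1 : E 1 = 0 := rfl
  have hE0 : E 0 = q 0 + k * |q 1| := rfl
  -- At parameter `1/2` the path is at `E`; as an entry is the first hit, it lies in the first leg
  -- and must be exactly at `1/2`.
  have hτm : τ ≤ m := by
    by_contra! hlt
    refine hγ'.notMem_of_lt_entry hv hτ m hlt ?_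
    rw [mem_highway, hcoord m le_rfl, hE1]
    simp [m]
  have hτ2 : (τ : ℝ) ≤ 1 / 2 := hτm
  have hτ1 := hτ.1
  rw [mem_highway, hcoord τ hτ2, hE1] at hτ1
  have hτ' : 2 * (τ : ℝ) = 1 := by
    have : (1 - 2 * (τ : ℝ)) * q 1 = 0 := by linarith
    linarith [(mul_eq_zero.1 this).resolve_right hq]
  have ht' : (t : ℝ) < τ := ht
  have habs : |γ' t 1| = (1 - 2 * t) * |q 1| := by
    rw [hcoord t (by linarith), hE1]
    have : q 1 + 2 * t * (0 - q 1) = (1 - 2 * t) * q 1 := by ring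
    rw [this, abs_mul, abs_of_nonneg (by linarith)]
  rw [habs, hcoord t (by linarith), hcoord τ hτ2, hE0, hτ']
  ring

end InfiniteSpeed

theorem mainTheorem5 :
    -- `1 ≤ p < ∞`: the incidence angle is `α(p, v)`, toward the destination
    (∀ (p : ℝ≥0∞) [Fact (1 ≤ p)], p ≠ ∞ → ∀ v : ℝ≥0∞, 1 < v →
      ∀ (q q' : LpPlane p) (γ : Path q q'), IsShortestTimePath v γ → UsesHighway γ →
        EntersWithAngle γ (SignType.sign (q' 0 - q 0) * incidenceAngle p v)) ∧
    -- the value for `p = 2`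
    (∀ v : ℝ≥0∞, 1 < v → incidenceAngle 2 v = Real.arcsin (v⁻¹).toReal) ∧
    -- `p = ∞`, `v < ∞`: the incidence angle is `π / 4`, toward the destination
    (∀ v : ℝ≥0∞, 1 < v → v ≠ ∞ →
      ∀ (q q' : LpPlane ∞) (γ : Path q q'), IsShortestTimePath v γ → UsesHighway γ →
        EntersWithAngle γ (SignType.sign (q' 0 - q 0) * (Real.pi / 4))) ∧
    -- `p = ∞`, `v = ∞`: the incidence angles lie in `[-π / 4, π / 4]`, and all of them occur
    (∀ (q q' : LpPlane ∞) (γ : Path q q'), IsShortestTimePath ∞ γ → UsesHighway γ →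
      (q ∉ highway ∞ → ∃ τ, IsEntryTime γ τ) ∧
      (∀ τ, IsEntryTime γ τ →
        (∀ t < τ, angleToNormal (γ t) (γ τ) ∈ Icc (-(Real.pi / 4)) (Real.pi / 4)) ∧
        ∀ θ, HasIncidenceAngle γ τ θ → θ ∈ Icc (-(Real.pi / 4)) (Real.pi / 4)) ∧
      (q ∉ highway ∞ → ∀ θ ∈ Icc (-(Real.pi / 4)) (Real.pi / 4),
        ∃ γ' : Path q q', IsShortestTimePath ∞ γ' ∧ UsesHighway γ' ∧
          EntersWithAngle γ' θ)) := by
  refine ⟨fun p _ hp v hv q q' γ hγ hu => hγ.entersWithAngle_incidenceAngle hp hv hu,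
    fun v hv => incidenceAngle_two hv,
    fun v hv hv' q q' γ hγ hu => hγ.entersWithAngle_pi_div_four hv hv' hu,
    fun q q' γ hγ hu => ⟨exists_isEntryTime hu, fun τ hτ =>
      ⟨fun t ht => hγ.angleToNormal_mem hu hτ ht, fun θ hθ => ?_⟩,
      fun hq θ hθ => hγ.exists_entersWithAngle hu hq hθ⟩⟩
  -- The bound on the chord angles passes to a limit because the range is closed and there are times
  -- before `τ`.
  have : (𝓝[<] τ).NeBot := nhdsLT_neBot_of_exists_lt ⟨0, hτ.pos⟩
  refine isClosed_Icc.mem_of_tendsto hθ ?_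
  filter_upwards [self_mem_nhdsWithin] with t ht
  exact hγ.angleToNormal_mem hu hτ ht
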